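/- Let $A\in\{0,1\}^{m\times n}$, let $b\in\mathbb{Z}_{\ge 0}^m$ be an integral constraint vector, $w\in\mathbb{R}^n$ and $X\in\mathbb{N}^n$. The packing LP is to maximize $w^Tx$ over all $x\in\mathbb{R}^n$ with $Ax\le b$ and $0\le x_v\le X_v$ for every $v$. Its factor graph is the bipartite graph with variable vertices $v\in\{1,\dots,n\}$, constraint vertices $C\in\{1,\dots,m\}$, and an edge $(v,C)$ whenever $A_{Cv}=1$; let $\mathcal{N}(\cdot)$ denote the set of neighbours. The min-sum packing algorithm with $t\in\mathbb{N}$ iterations is the following (a maximum over the empty set is $-\infty$). 1. Set $\mu^{(0)}_{C\to v}(\beta)=0$ for every edge $(v,C)$ and $\beta\in\{0,\dots,X_v\}$. 2. For $t'=1,\dots,t$, for every edge $(v,C)$ and $\beta\in\{0,\dots,X_v\}$, set $$\mu^{(t')}_{v\to C}(\beta)=w_v\beta+\sum_{C'\in\mathcal{N}(v)\setminus\{C\}}\mu^{(t'-1)}_{C'\to v}(\beta),$$ and then $$\mu^{(t')}_{C\to v}(\beta)=\max\Big\{\sum_{u\in\mathcal{N}(C)\setminus\{v\}}\mu^{(t')}_{u\to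 C}(z_u)\ :\ z\in\prod_u\{0,\dots,X_u\},\ z_v=\beta,\ \sum_{u\in\mathcal{N}(C)}z_u\le b_C\Big\}.$$ 3. For every $v$ let $\mu_v(\beta)=w_v\beta+\sum_{C\in\mathcal{N}(v)}\mu^{(t)}_{C\to v}(\beta)$, and let $\delta_{v,t}$ be the set of $\beta\in\{0,\dots,X_v\}$ that maximize $\mu_v(\beta)$. The output is $\hat{x}_v=\max\delta_{v,t}$ if $t$ is even and $\hat{x}_v=\min\delta_{v,t}$ if $t$ is odd. **Corollary.** If $x$ is an optimal solution of the packing LP and $x_r$ is not an integer, then for every $t\in\mathbb{N}$ the output $\hat{x}$ of the algorithm with $t$ iterations satisfies $\hat{x}_r\ge\lceil x_r\rceil$ if $t$ is even and $\hat{x}_r\le\lfloor x_r\rfloor$ if $t$ is odd. -/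

import Mathlib

/-!
Farkas' lemma gives multipliers `y ≥ 0` of the constraints `A x ≤ b` that satisfy complementary
slackness with the optimal solution `x`. Replace every message `μ_{C → v}(β)` by
`μ_{C → v}(β) + y_C β`. After an even number of iterations it is then monotone in `β ≤ ⌈x_v⌉`, and
after an odd number it is antitone in `β ≥ ⌊x_v⌋`. Indeed, suppose that `z` is feasible at `C` and
`z_v < x_v`. Then `z_v` can be raised by one: either `C` has slack, or some other coordinate has
`z_u > x_u` and gives up the unit, which the messages of the previous iteration reward. If
`z_v > x_v`, then the unit passes to a coordinate with `z_u < x_u`, or else `z` exceeds `x` around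
`C`; in the latter case the unit is dropped, at no cost if `y_C = 0`, and `y_C > 0` is impossible
because then `C` is tight at `x`. At a variable the tilts add up to the reduced weight
`w_v - ∑_C y_C`, which complementary slackness makes nonnegative if `x_v > 0` and nonpositive if
`x_v < X_v`. So after an even number of iterations the largest maximizer of the final value is at
least `x_v`, and after an odd number the smallest is at most `x_v`.
-/

noncomputable section

open scoped Matrix

/-- The data of a packing problem with variables indexed by `V` and constraints indexed by `C`:
a zero-one constraint matrix `A`, an integral constraint vector `b`, real weights `w`
and the upper bounds `X` of the variables. -/
structure PackingProblem (V C : Type*) where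
  /-- the constraint matrix: rows are constraints, columns are variables -/
  A : Matrix C V ℕ
  zero_one : ∀ c v, A c v = 0 ∨ A c v = 1
  /-- the constraint vector -/
  b : C → ℕ
  /-- the weight vector -/
  w : V → ℝ
  /-- the domain boundary vector -/
  X : V → ℕ

/-- A factor graph model `⟨G, Ψ, Φ, X⟩`: a bipartite graph on the variable vertices `V` and the
constraint vertices `C`, given by its edges; a factor function `ψ c` with values in `ℝ ∪ {-∞}`
for each constraint vertex; a variable function `φ v` for each variable vertex;
and the alphabet `{0, …, X v}` of each variable vertex. -/
structure FactorGraphModel (V C : Type*) where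
  E : Finset (V × C)
  ψ : C → (V → ℕ) → WithBot ℝ
  φ : V → ℕ → ℝ
  X : V → ℕ

/-- The set of integral vectors `z` with `0 ≤ z v ≤ X v` for all `v`. -/
def zBox {V : Type*} [Fintype V] [DecidableEq V] (X : V → ℕ) : Finset (V → ℕ) :=
  Fintype.piFinset fun v => Finset.range (X v + 1)

/-- The set of real vectors `x` with `0 ≤ x v ≤ X v` for all `v`. -/
def rBox {V : Type*} (X : V → ℕ) : Set (V → ℝ) :=
  {x | ∀ v, 0 ≤ x v ∧ x v ≤ (X v : ℝ)}

namespace FactorGraphModel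

variable {V C : Type*} [Fintype V] [Fintype C] [DecidableEq V] [DecidableEq C]

/-- The constraint vertices adjacent to the variable vertex `v`. -/
def nbrV (M : FactorGraphModel V C) (v : V) : Finset C :=
  Finset.univ.filter fun c => (v, c) ∈ M.E

/-- The variable vertices adjacent to the constraint vertex `c`. -/
def nbrC (M : FactorGraphModel V C) (c : C) : Finset V :=
  Finset.univ.filter fun v => (v, c) ∈ M.E

/-- The variable-to-constraint message `v → c`, computed from the constraint-to-variable
messages `μ` of the previous iteration. -/
def varMsg (M : FactorGraphModel V C) (μ : C → V → ℕ → WithBot ℝ)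
    (v : V) (c : C) (β : ℕ) : WithBot ℝ :=
  ((M.φ v β : ℝ) : WithBot ℝ) + ∑ c' ∈ (M.nbrV v).erase c, μ c' v β

open Classical in
/-- The constraint-to-variable message `c → v`, computed from the variable-to-constraint
messages `ν` of the same iteration. A maximum over the empty set is `⊥`, that is `-∞`. -/
def conMsg (M : FactorGraphModel V C) (ν : V → C → ℕ → WithBot ℝ)
    (c : C) (v : V) (β : ℕ) : WithBot ℝ :=
  ((zBox M.X).filter fun z => z v = β ∧ M.ψ c z = 0).sup
    fun z => ∑ u ∈ (M.nbrC c).erase v, ν u c (z u)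

/-- The constraint-to-variable messages after `t` iterations, with zero initialization.
Only the values on edges `(v, c)` and at `β ≤ X v` matter. -/
def msg (M : FactorGraphModel V C) : ℕ → C → V → ℕ → WithBot ℝ
  | 0 => fun _ _ _ => 0
  | t + 1 => M.conMsg (M.varMsg (M.msg t))

/-- The final value computed by the variable vertex `v` for the assignment of `β` to `v`. -/
def finalValue (M : FactorGraphModel V C) (t : ℕ) (v : V) (β : ℕ) : WithBot ℝ :=
  ((M.φ v β : ℝ) : WithBot ℝ) + ∑ c ∈ M.nbrV v, M.msg t c v β

/-- The largest final value at `v`. -/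
def maxValue (M : FactorGraphModel V C) (t : ℕ) (v : V) : WithBot ℝ :=
  (Finset.range (M.X v + 1)).sup fun β => M.finalValue t v β

open Classical in
/-- The set of the values `β ∈ {0, …, X v}` that attain the largest final value at `v`. -/
def delta (M : FactorGraphModel V C) (t : ℕ) (v : V) : Finset ℕ :=
  (Finset.range (M.X v + 1)).filter fun β => M.finalValue t v β = M.maxValue t v

theorem delta_nonempty (M : FactorGraphModel V C) (t : ℕ) (v : V) : (M.delta t v).Nonempty := by
  classical
  obtain ⟨β, hβ, h⟩ := Finset.exists_mem_eq_sup (Finset.range (M.X v + 1))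
    ⟨0, by simp⟩ (fun β => M.finalValue t v β)
  exact ⟨β, by
    rw [delta, Finset.mem_filter]
    exact ⟨hβ, h.symm⟩⟩

/-- The output of the min-sum algorithm for packing after `t` iterations. -/
def minSumPacking (M : FactorGraphModel V C) (t : ℕ) (v : V) : ℕ :=
  if Even t then (M.delta t v).max' (M.delta_nonempty t v)
  else (M.delta t v).min' (M.delta_nonempty t v)

end FactorGraphModel

namespace PackingProblem

variable {V C : Type*} [Fintype V] [Fintype C]

/-- The feasible set of the packing LP. -/
def feasibleLP (P : PackingProblem V C) : Set (V → ℝ) :=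
  {x | x ∈ rBox P.X ∧ ∀ c, (P.A.map (Nat.cast : ℕ → ℝ) *ᵥ x) c ≤ (P.b c : ℝ)}

/-- The set of optimal solutions of the packing LP, which maximizes the weight. -/
def optLP (P : PackingProblem V C) : Set (V → ℝ) :=
  {x | x ∈ P.feasibleLP ∧ ∀ y ∈ P.feasibleLP, P.w ⬝ᵥ y ≤ P.w ⬝ᵥ x}

/-- The factor graph model of a packing problem. -/
def factorGraphModel (P : PackingProblem V C) : FactorGraphModel V C where
  E := Finset.univ.filter fun e => P.A e.2 e.1 = 1
  ψ := fun c y =>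
    if (∑ v ∈ Finset.univ.filter (fun v => P.A c v = 1), y v) ≤ P.b c then 0 else ⊥
  φ := fun v β => P.w v * (β : ℝ)
  X := P.X

end PackingProblem

end

section LinearProgramming

theorem exists_nonneg_sum_insert_smul_eq {R M ι : Type*} [Semiring R] [Preorder R]
    [AddCommMonoid M] [Module R M] [DecidableEq ι] {s : Finset ι} {a : ι} (ha : a ∉ s)
    (f : ι → M) {c : ι → R} (hc : ∀ i, 0 ≤ c i) {k : R} (hk : 0 ≤ k) :
    ∃ c' : ι → R, (∀ i, 0 ≤ c' i) ∧
      ∑ i ∈ insert a s, c' i • f i = k • f a + ∑ i ∈ s, c i • f i := by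
  refine ⟨Function.update c a k, fun i => ?_, ?_⟩
  · rcases eq_or_ne i a with rfl | hi
    · simpa using hk
    · simpa [hi] using hc i
  · rw [Finset.sum_insert ha, Function.update_self]
    congr 1
    exact Finset.sum_congr rfl fun i hi => by
      rw [Function.update_of_ne (ne_of_mem_of_not_mem hi ha)]

variable {𝕜 E ι : Type*} [Field 𝕜] [LinearOrder 𝕜] [IsStrictOrderedRing 𝕜]
  [AddCommGroup E] [Module 𝕜 E]

theorem farkas (s : Finset ι) (f : ι → Module.Dual 𝕜 E) (g : Module.Dual 𝕜 E)
    (h : ∀ d, (∀ i ∈ s, f i d ≤ 0) → g d ≤ 0) :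
    ∃ c : ι → 𝕜, (∀ i, 0 ≤ c i) ∧ ∑ i ∈ s, c i • f i = g := by
  classical
  induction s using Finset.induction_on generalizing f g with
  | empty =>
    refine ⟨0, fun _ => le_rfl, LinearMap.ext fun d => le_antisymm ?_ (h d (by simp))⟩
    simpa using h (-d) (by simp)
  | insert a s ha ih =>
    by_cases hs : ∀ d, (∀ i ∈ s, f i d ≤ 0) → g d ≤ 0
    · obtain ⟨c, hc, rfl⟩ := ih f g hs
      simpa using exists_nonneg_sum_insert_smul_eq ha f hc le_rfl
    obtain ⟨d₀, hd₀, hg₀, ha₀⟩ :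
        ∃ d₀, (∀ i ∈ s, f i d₀ ≤ 0) ∧ 0 ≤ g d₀ ∧ f a d₀ = 1 := by
      push Not at hs
      obtain ⟨d, hd, hgd⟩ := hs
      have had : 0 < f a d := by
        by_contra! had
        exact (h d (Finset.forall_mem_insert _ _ _ |>.2 ⟨had, hd⟩)).not_gt hgd
      refine ⟨(f a d)⁻¹ • d, fun i hi => ?_, ?_, ?_⟩
      · simpa using mul_nonpos_of_nonneg_of_nonpos (inv_nonneg.2 had.le) (hd i hi)
      · simpa using mul_nonneg (inv_nonneg.2 had.le) hgd.le
      · simp [had.ne']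
    -- Project along `d₀` onto the kernel of `f a`, where the constraint `a` is void.
    let π : E →ₗ[𝕜] E := LinearMap.id - (f a).smulRight d₀
    have hπ : ∀ d, π d = d - f a d • d₀ := fun d => rfl
    obtain ⟨c, hc, hgc⟩ := ih (fun i => f i ∘ₗ π) (g ∘ₗ π) fun d hd =>
      h (π d) (Finset.forall_mem_insert _ _ _ |>.2 ⟨by simp [hπ, ha₀], hd⟩)
    set e : Module.Dual 𝕜 E := g - ∑ i ∈ s, c i • f i with he
    have he_smul : e d₀ • f a = e := LinearMap.ext fun d => by
      have h0 : e (π d) = 0 := by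
        simpa [he, sub_eq_zero] using (LinearMap.congr_fun hgc d).symm
      rw [hπ, map_sub, map_smul, smul_eq_mul, sub_eq_zero] at h0
      rw [LinearMap.smul_apply, smul_eq_mul, h0, mul_comm]
    have he_nonneg : 0 ≤ e d₀ := by
      have : ∑ i ∈ s, c i * f i d₀ ≤ 0 :=
        Finset.sum_nonpos fun i hi => mul_nonpos_of_nonneg_of_nonpos (hc i) (hd₀ i hi)
      simpa [he] using this.trans hg₀
    have hg : e d₀ • f a + ∑ i ∈ s, c i • f i = g := by rw [he_smul, he, sub_add_cancel]
    exact hg ▸ exists_nonneg_sum_insert_smul_eq ha f hc he_nonneg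

theorem exists_pos_forall_map_add_smul_le [Finite ι] {f : ι → Module.Dual 𝕜 E} {b : ι → 𝕜} {x d : E}
    (hx : ∀ i, f i x ≤ b i) (hd : ∀ i, f i x = b i → f i d ≤ 0) :
    ∃ ε : 𝕜, 0 < ε ∧ ∀ i, f i (x + ε • d) ≤ b i := by
  have hlarge : ∀ i, ∀ᶠ N : 𝕜 in Filter.atTop, f i d ≤ N * (b i - f i x) := fun i => by
    rcases (hx i).eq_or_lt with h | h
    · simp [h, hd i h]
    · exact (Filter.tendsto_id.atTop_mul_const (sub_pos.2 h)).eventually_ge_atTop _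
  obtain ⟨N, hN, hN0⟩ :=
    ((Filter.eventually_all.2 hlarge).and (Filter.eventually_gt_atTop 0)).exists
  refine ⟨N⁻¹, inv_pos.2 hN0, fun i => ?_⟩
  have := (inv_mul_le_iff₀ hN0).2 (hN i)
  rw [map_add, map_smul, smul_eq_mul]
  linarith

theorem exists_complementary_multipliers [Fintype ι] {f : ι → Module.Dual 𝕜 E} {b : ι → 𝕜}
    {g : Module.Dual 𝕜 E} {x : E} (hx : ∀ i, f i x ≤ b i)
    (hmax : ∀ y, (∀ i, f i y ≤ b i) → g y ≤ g x) :
    ∃ c : ι → 𝕜, (∀ i, 0 ≤ c i) ∧ (∀ i, f i x < b i → c i = 0) ∧ ∑ i, c i • f i = g := by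
  classical
  obtain ⟨c, hc, hgc⟩ := farkas {i | f i x = b i} f g fun d hd => by
    obtain ⟨ε, hε, hfeas⟩ := exists_pos_forall_map_add_smul_le hx (by simpa using hd)
    have := hmax _ hfeas
    rw [map_add, map_smul, smul_eq_mul, add_le_iff_nonpos_right] at this
    exact nonpos_of_mul_nonpos_right this hε
  refine ⟨fun i => if f i x = b i then c i else 0, fun i => ?_, fun i hi => if_neg hi.ne, ?_⟩
  · dsimp only
    split_ifs
    exacts [hc i, le_rfl]
  · simpa [Finset.sum_filter, ite_smul] using hgc

end LinearProgramming

section Tilt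

/-- The function `β ↦ f β + a β`. Tilting the messages by the dual multipliers turns the slope
bounds that the min-sum iteration preserves into monotonicity. -/
def tilt (a : ℝ) (f : ℕ → WithBot ℝ) (β : ℕ) : WithBot ℝ :=
  f β + ((a * β : ℝ) : WithBot ℝ)

theorem tilt_tilt (a b : ℝ) (f : ℕ → WithBot ℝ) : tilt a (tilt b f) = tilt (a + b) f := by
  ext1 β
  simp only [tilt, add_assoc, ← WithBot.coe_add]
  ring_nf

theorem sum_tilt {ι : Type*} (s : Finset ι) (a : ι → ℝ) (f : ι → ℕ → WithBot ℝ) :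
    ∑ i ∈ s, tilt (a i) (f i) = tilt (∑ i ∈ s, a i) (∑ i ∈ s, f i) := by
  ext1 β
  simp [tilt, Finset.sum_add_distrib, Finset.sum_mul]

theorem monotoneOn_tilt {a : ℝ} (ha : 0 ≤ a) {f : ℕ → WithBot ℝ} {s : Set ℕ}
    (hf : MonotoneOn f s) : MonotoneOn (tilt a f) s := fun _ hβ _ hγ hβγ =>
  add_le_add (hf hβ hγ hβγ) (WithBot.coe_le_coe.2 (by gcongr))

theorem antitoneOn_tilt {a : ℝ} (ha : a ≤ 0) {f : ℕ → WithBot ℝ} {s : Set ℕ}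
    (hf : AntitoneOn f s) : AntitoneOn (tilt a f) s := fun _ hβ _ hγ hβγ =>
  add_le_add (hf hβ hγ hβγ)
    (WithBot.coe_le_coe.2 (mul_le_mul_of_nonpos_left (Nat.cast_le.2 hβγ) ha))

theorem monotoneOn_sum {ι α M : Type*} [Preorder α] [AddCommMonoid M] [PartialOrder M]
    [IsOrderedAddMonoid M] {s : Finset ι} {f : ι → α → M} {t : Set α}
    (hf : ∀ i ∈ s, MonotoneOn (f i) t) : MonotoneOn (∑ i ∈ s, f i) t := fun a ha b hb hab => by
  simpa only [Finset.sum_apply] using Finset.sum_le_sum fun i hi => hf i hi ha hb hab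

theorem antitoneOn_sum {ι α M : Type*} [Preorder α] [AddCommMonoid M] [PartialOrder M]
    [IsOrderedAddMonoid M] {s : Finset ι} {f : ι → α → M} {t : Set α}
    (hf : ∀ i ∈ s, AntitoneOn (f i) t) : AntitoneOn (∑ i ∈ s, f i) t :=
  monotoneOn_sum (M := Mᵒᵈ) hf

theorem tilt_sum_erase_apply {V : Type*} [DecidableEq V] {S : Finset V} {v : V} (hv : v ∈ S)
    (f : V → ℕ → WithBot ℝ) (a : ℝ) (z : V → ℕ) :
    ∑ u ∈ S.erase v, f u (z u) + ((a * z v : ℝ) : WithBot ℝ) =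
      ∑ u ∈ S.erase v, tilt (-a) (f u) (z u) + ((a * ∑ u ∈ S, z u : ℝ) : WithBot ℝ) := by
  simp only [tilt, Finset.sum_add_distrib, add_assoc, ← WithBot.coe_sum, ← WithBot.coe_add]
  simp [← Finset.sum_erase_add S z hv, mul_add, Finset.mul_sum]

end Tilt

section UnitMoves

variable {V : Type*} [DecidableEq V] {X z : V → ℕ} {S : Finset V} {u v : V}

theorem mem_zBox [Fintype V] : z ∈ zBox X ↔ ∀ v, z v ≤ X v := by
  simp [zBox]

theorem sum_add_single_one (hv : v ∈ S) (z : V → ℕ) :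
    ∑ i ∈ S, (z + Pi.single v 1 : V → ℕ) i = ∑ i ∈ S, z i + 1 := by
  simp [Finset.sum_add_distrib, Finset.sum_pi_single', hv]

theorem sum_sub_single_one (hu : u ∈ S) (hz : 0 < z u) :
    ∑ i ∈ S, (z - Pi.single u 1 : V → ℕ) i + 1 = ∑ i ∈ S, z i := by
  have hle : Pi.single u 1 ≤ z := fun i => by
    rcases eq_or_ne i u with rfl | hi
    · simpa using Nat.one_le_of_lt hz
    · simp [hi]
  rw [← sum_add_single_one hu, tsub_add_cancel_of_le hle]

/-- The vector obtained from `z` by moving one unit from the coordinate `u` to the coordinate `v`.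
If `z u = 0`, then truncated subtraction leaves `u` at zero and only `v` is raised. -/
def moveUnit (z : V → ℕ) (u v : V) : V → ℕ :=
  z - Pi.single u 1 + Pi.single v 1

theorem sum_moveUnit (hu : u ∈ S) (hv : v ∈ S) (hz : 0 < z u) :
    ∑ i ∈ S, moveUnit z u v i = ∑ i ∈ S, z i := by
  rw [moveUnit, sum_add_single_one hv, sum_sub_single_one hu hz]

theorem moveUnit_source (huv : u ≠ v) : moveUnit z u v u = z u - 1 := by
  simp [moveUnit, huv]

theorem moveUnit_target (huv : u ≠ v) : moveUnit z u v v = z v + 1 := by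
  simp [moveUnit, huv.symm]

theorem moveUnit_of_ne {i : V} (hu : i ≠ u) (hv : i ≠ v) : moveUnit z u v i = z i := by
  simp [moveUnit, hu, hv]

variable [Fintype V]

theorem add_single_one_mem_zBox (hz : z ∈ zBox X) (hv : z v < X v) :
    z + Pi.single v 1 ∈ zBox X := by
  refine mem_zBox.2 fun i => ?_
  rcases eq_or_ne i v with rfl | hi
  · simpa using hv
  · simpa [hi] using mem_zBox.1 hz i

theorem sub_single_one_mem_zBox (hz : z ∈ zBox X) (u : V) : z - Pi.single u 1 ∈ zBox X :=
  mem_zBox.2 fun i => (Nat.sub_le _ _).trans (mem_zBox.1 hz i)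

theorem moveUnit_mem_zBox (hz : z ∈ zBox X) (huv : u ≠ v) (hv : z v < X v) :
    moveUnit z u v ∈ zBox X :=
  add_single_one_mem_zBox (sub_single_one_mem_zBox hz u) (by simpa [huv.symm] using hv)

variable {x : V → ℝ} {B : ℕ}

theorem exists_raise_coordinate (hx : x ∈ rBox X) (hxB : ∑ u ∈ S, x u ≤ B) (hz : z ∈ zBox X)
    (hzB : ∑ u ∈ S, z u ≤ B) (hv : v ∈ S) (hzx : z v < x v) :
    ∃ z' ∈ zBox X, z' v = z v + 1 ∧ ∑ u ∈ S, z' u ≤ B ∧ ∑ u ∈ S, z u ≤ ∑ u ∈ S, z' u ∧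
      ∀ u ≠ v, z' u = z u ∨ ⌊x u⌋₊ ≤ z' u ∧ z' u ≤ z u := by
  have hzX : z v < X v := by exact_mod_cast hzx.trans_le (hx v).2
  rcases hzB.lt_or_eq with hslack | htight
  · refine ⟨z + Pi.single v 1, add_single_one_mem_zBox hz hzX, by simp, ?_, ?_,
      fun u hu => .inl (by simp [hu])⟩ <;> rw [sum_add_single_one hv] <;> lia
  · obtain ⟨u, hu, hxu⟩ : ∃ u ∈ S, x u < z u := by
      by_contra! hle
      have := Finset.sum_lt_sum hle ⟨v, hv, hzx⟩
      rw [← Nat.cast_sum, htight] at this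
      exact this.not_ge hxB
    have huv : u ≠ v := by
      rintro rfl
      exact lt_asymm hxu hzx
    have hfloor : ⌊x u⌋₊ < z u := (Nat.floor_lt (hx u).1).2 hxu
    have hsum := sum_moveUnit hu hv (Nat.zero_lt_of_lt hfloor)
    refine ⟨moveUnit z u v, moveUnit_mem_zBox hz huv hzX, moveUnit_target huv,
      hsum.trans_le hzB, hsum.ge, fun i hi => ?_⟩
    rcases eq_or_ne i u with rfl | hiu
    · rw [moveUnit_source huv]
      exact .inr ⟨Nat.le_sub_one_of_lt hfloor, Nat.sub_le _ _⟩
    · exact .inl (moveUnit_of_ne hiu hi)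

theorem exists_lower_coordinate (hx : x ∈ rBox X) (hz : z ∈ zBox X)
    (hzB : ∑ u ∈ S, z u ≤ B) (hv : v ∈ S) (hxz : x v < z v) :
    ∃ z' ∈ zBox X, z' v + 1 = z v ∧ ∑ u ∈ S, z' u ≤ B ∧
      (∑ u ∈ S, x u = B → ∑ u ∈ S, z' u = ∑ u ∈ S, z u) ∧
      ∀ u ≠ v, z' u = z u ∨ z u ≤ z' u ∧ z' u ≤ ⌈x u⌉₊ := by
  have hzv : 0 < z v := Nat.cast_pos.1 ((hx v).1.trans_lt hxz)
  by_cases hlt : ∃ u ∈ S, z u < x u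
  · obtain ⟨u, hu, hzu⟩ := hlt
    have huv : v ≠ u := by
      rintro rfl
      exact lt_asymm hzu hxz
    have huX : z u < X u := by exact_mod_cast hzu.trans_le (hx u).2
    have hsum := sum_moveUnit hv hu hzv
    refine ⟨moveUnit z v u, moveUnit_mem_zBox hz huv huX, ?_, hsum.trans_le hzB,
      fun _ => hsum, fun i hi => ?_⟩
    · rw [moveUnit_source huv, Nat.sub_add_cancel hzv]
    rcases eq_or_ne i u with rfl | hiu
    · rw [moveUnit_target huv]
      exact .inr ⟨Nat.le_succ _, Nat.lt_ceil.2 hzu⟩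
    · exact .inl (moveUnit_of_ne hi hiu)
  · push Not at hlt
    have hxB : ∑ u ∈ S, x u < B :=
      (Finset.sum_lt_sum hlt ⟨v, hv, hxz⟩).trans_le (by exact_mod_cast hzB)
    have hsum := sum_sub_single_one hv hzv
    exact ⟨z - Pi.single v 1, sub_single_one_mem_zBox hz v, by simpa using Nat.sub_add_cancel hzv,
      by lia, fun h => absurd h hxB.ne, fun u hu => .inl (by simp [hu])⟩

end UnitMoves

namespace FactorGraphModel

variable {V C : Type*} [Fintype V] [DecidableEq V] [DecidableEq C]
  {M : FactorGraphModel V C} {t k : ℕ} {v : V}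

theorem conMsg_add_le_conMsg_add {ν : V → C → ℕ → WithBot ℝ} {c : C} {β γ : ℕ} {a b : WithBot ℝ}
    (h : ∀ z ∈ zBox M.X, z v = β → M.ψ c z = 0 → ∃ z' ∈ zBox M.X, z' v = γ ∧ M.ψ c z' = 0 ∧
      ∑ u ∈ (M.nbrC c).erase v, ν u c (z u) + a ≤ ∑ u ∈ (M.nbrC c).erase v, ν u c (z' u) + b) :
    M.conMsg ν c v β + a ≤ M.conMsg ν c v γ + b := by
  classical
  unfold conMsg
  rcases Finset.eq_empty_or_nonempty {z ∈ zBox M.X | z v = β ∧ M.ψ c z = 0} with hempty | hne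
  · simp [hempty]
  · obtain ⟨z, hz, hsup⟩ := Finset.exists_mem_eq_sup _ hne
      fun z : V → ℕ => ∑ u ∈ (M.nbrC c).erase v, ν u c (z u)
    simp only [Finset.mem_filter] at hz
    obtain ⟨z', hz'X, hz'v, hz'ψ, hle⟩ := h z hz.1 hz.2.1 hz.2.2
    rw [hsup]
    refine hle.trans ?_
    gcongr
    exact Finset.le_sup (f := fun z : V → ℕ => ∑ u ∈ (M.nbrC c).erase v, ν u c (z u))
      (by simp only [Finset.mem_filter]; exact ⟨hz'X, hz'v, hz'ψ⟩)

variable [Fintype C]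

theorem mem_delta {β : ℕ} :
    β ∈ M.delta t v ↔ β ≤ M.X v ∧ ∀ γ ≤ M.X v, M.finalValue t v γ ≤ M.finalValue t v β := by
  rw [delta, Finset.mem_filter, Finset.mem_range, Nat.lt_succ_iff]
  refine and_congr_right fun hβ => ⟨fun h γ hγ => ?_, fun h => le_antisymm ?_ ?_⟩
  · rw [h]
    exact Finset.le_sup (f := M.finalValue t v) (Finset.mem_range_succ_iff.2 hγ)
  · exact Finset.le_sup (f := M.finalValue t v) (Finset.mem_range_succ_iff.2 hβ)
  · exact Finset.sup_le fun γ hγ => h γ (Finset.mem_range_succ_iff.1 hγ)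

theorem le_minSumPacking (ht : Even t) (hk : k ≤ M.X v)
    (hmono : MonotoneOn (M.finalValue t v) (Set.Iic k)) : k ≤ M.minSumPacking t v := by
  rw [minSumPacking, if_pos ht]
  have hmax := (mem_delta.1 ((M.delta t v).max'_mem (M.delta_nonempty t v))).2
  by_contra! hlt
  have hmem : k ∈ M.delta t v := mem_delta.2 ⟨hk, fun γ hγ =>
    (hmax γ hγ).trans (hmono hlt.le Set.self_mem_Iic hlt.le)⟩
  exact hlt.not_ge (Finset.le_max' _ k hmem)

theorem minSumPacking_le (ht : Odd t)
    (hanti : AntitoneOn (M.finalValue t v) (Set.Icc k (M.X v))) : M.minSumPacking t v ≤ k := by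
  rw [minSumPacking, if_neg (Nat.not_even_iff_odd.2 ht)]
  obtain ⟨hX, hmax⟩ := mem_delta.1 ((M.delta t v).min'_mem (M.delta_nonempty t v))
  by_contra! hlt
  have hkX : k ≤ M.X v := hlt.le.trans hX
  have hmem : k ∈ M.delta t v := mem_delta.2 ⟨hkX, fun γ hγ =>
    (hmax γ hγ).trans (hanti ⟨le_rfl, hkX⟩ ⟨hlt.le, hX⟩ hlt.le)⟩
  exact hlt.not_ge (Finset.min'_le _ k hmem)

end FactorGraphModel

namespace PackingProblem

open scoped Matrix

variable {V C : Type*} [Fintype V] {P : PackingProblem V C} {x : V → ℝ} {y : C → ℝ}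

theorem mulVec_apply_eq_sum (P : PackingProblem V C) (x : V → ℝ) (c : C) :
    (P.A.map (Nat.cast : ℕ → ℝ) *ᵥ x) c = ∑ v with P.A c v = 1, x v := by
  rw [Finset.sum_filter]
  refine Finset.sum_congr rfl fun v _ => ?_
  rcases P.zero_one c v with h | h <;> simp [h]

theorem mem_feasibleLP :
    x ∈ P.feasibleLP ↔ x ∈ rBox P.X ∧ ∀ c, ∑ v with P.A c v = 1, x v ≤ P.b c := by
  simp only [feasibleLP, Set.mem_ofPred_eq, mulVec_apply_eq_sum]

variable [Fintype C]

/-- The weight of `v` minus the total price, under the prices `y`, of the constraints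
containing `v`. -/
def reducedWeight (P : PackingProblem V C) (y : C → ℝ) (v : V) : ℝ :=
  P.w v - ∑ c with P.A c v = 1, y c

/-- `x` is feasible for the packing LP and `y` is a vector of multipliers of the constraints
`A x ≤ b` that satisfies complementary slackness with `x`. The multipliers of the bounds
`0 ≤ x v ≤ X v` are eliminated: they are the negative and positive parts of the reduced weights. -/
structure IsOptimalPair (P : PackingProblem V C) (x : V → ℝ) (y : C → ℝ) : Prop where
  feasible : x ∈ P.feasibleLP
  nonneg : ∀ c, 0 ≤ y c
  tight : ∀ c, 0 < y c → ∑ v with P.A c v = 1, x v = P.b c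
  reducedWeight_nonneg : ∀ v, 0 < x v → 0 ≤ P.reducedWeight y v
  reducedWeight_nonpos : ∀ v, x v < P.X v → P.reducedWeight y v ≤ 0

theorem exists_isOptimalPair (hx : x ∈ P.optLP) : ∃ y, P.IsOptimalPair x y := by
  classical
  obtain ⟨hfeas, hopt⟩ := hx
  let f : C ⊕ V ⊕ V → Module.Dual ℝ (V → ℝ) := Sum.elim
    (fun c => ∑ v with P.A c v = 1, LinearMap.proj v)
    (Sum.elim (fun v => LinearMap.proj v) (fun v => -LinearMap.proj v))
  let B : C ⊕ V ⊕ V → ℝ := Sum.elim (fun c => P.b c) (Sum.elim (fun v => P.X v) 0)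
  have hfB : ∀ z, (∀ i, f i z ≤ B i) ↔ z ∈ P.feasibleLP := fun z => by
    simp only [mem_feasibleLP, rBox, Set.mem_ofPred_eq, forall_and, Sum.forall]
    simp [f, B, and_comm]
  let g : Module.Dual ℝ (V → ℝ) := ∑ v, P.w v • LinearMap.proj v
  have hg : ∀ z, g z = P.w ⬝ᵥ z := fun z => by simp [g, dotProduct]
  obtain ⟨q, hq, hslack, hsum⟩ := exists_complementary_multipliers (b := B) (g := g)
    ((hfB x).2 hfeas) fun z hz => by simpa only [hg] using hopt z ((hfB z).1 hz)
  have hred : ∀ v, P.reducedWeight (q ∘ .inl) v = q (.inr (.inl v)) - q (.inr (.inr v)) :=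
    fun v => by
      have hv := LinearMap.congr_fun hsum (Pi.single v 1)
      rw [hg, dotProduct_single_one] at hv
      simp only [reducedWeight, ← hv, Finset.sum_filter]
      simp [f, Pi.single_apply, sub_eq_add_neg]
  refine ⟨q ∘ .inl, hfeas, fun c => hq _, fun c hc => ?_, fun v hv => ?_, fun v hv => ?_⟩
  · refine ((mem_feasibleLP.1 hfeas).2 c).eq_of_not_lt fun hlt => hc.ne' ?_
    exact hslack (.inl c) (by simpa [f, B] using hlt)
  · rw [hred, hslack (.inr (.inr v)) (by simpa [f, B] using hv), sub_zero]
    exact hq _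
  · rw [hred, hslack (.inr (.inl v)) (by simpa [f, B] using hv), zero_sub, neg_nonpos]
    exact hq _

namespace IsOptimalPair

variable {f : ℕ → WithBot ℝ} {v : V}

theorem monotoneOn_tilt_reducedWeight (h : P.IsOptimalPair x y)
    (hf : MonotoneOn f (Set.Iic ⌈x v⌉₊)) :
    MonotoneOn (tilt (P.reducedWeight y v) f) (Set.Iic ⌈x v⌉₊) := by
  rcases lt_or_ge 0 (x v) with hv | hv
  · exact monotoneOn_tilt (h.reducedWeight_nonneg v hv) hf
  · rw [Nat.ceil_eq_zero.2 hv, ← bot_eq_zero, Set.Iic_bot]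
    exact Set.subsingleton_singleton.monotoneOn _

theorem antitoneOn_tilt_reducedWeight (h : P.IsOptimalPair x y)
    (hf : AntitoneOn f (Set.Icc ⌊x v⌋₊ (P.X v))) :
    AntitoneOn (tilt (P.reducedWeight y v) f) (Set.Icc ⌊x v⌋₊ (P.X v)) := by
  rcases lt_or_ge (x v) (P.X v) with hv | hv
  · exact antitoneOn_tilt (h.reducedWeight_nonpos v hv) hf
  · exact (Set.subsingleton_Icc_of_ge (Nat.le_floor hv)).antitoneOn _

end IsOptimalPair

section Messages

variable [DecidableEq V] [DecidableEq C] {c : C} {u v : V} {μ : C → V → ℕ → WithBot ℝ}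
  {ν : V → C → ℕ → WithBot ℝ}

theorem nbrV_eq (P : PackingProblem V C) (v : V) :
    P.factorGraphModel.nbrV v = ({c | P.A c v = 1} : Finset C) := by
  ext
  simp [factorGraphModel, FactorGraphModel.nbrV]

theorem nbrC_eq (P : PackingProblem V C) (c : C) :
    P.factorGraphModel.nbrC c = ({v | P.A c v = 1} : Finset V) := by
  ext
  simp [factorGraphModel, FactorGraphModel.nbrC]

theorem mem_nbrV_iff_mem_nbrC :
    c ∈ P.factorGraphModel.nbrV v ↔ v ∈ P.factorGraphModel.nbrC c := by
  simp [nbrV_eq, nbrC_eq]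

theorem psi_eq_zero_iff {z : V → ℕ} :
    P.factorGraphModel.ψ c z = 0 ↔ ∑ u ∈ P.factorGraphModel.nbrC c, z u ≤ P.b c := by
  rw [nbrC_eq]
  simp [factorGraphModel]

theorem tilt_varMsg (hc : c ∈ P.factorGraphModel.nbrV v) (y : C → ℝ) :
    tilt (-y c) (P.factorGraphModel.varMsg μ v c) = tilt (P.reducedWeight y v)
      (∑ c' ∈ (P.factorGraphModel.nbrV v).erase c, tilt (y c') (μ c' v)) := by
  have hvar : P.factorGraphModel.varMsg μ v c =
      tilt (P.w v) (∑ c' ∈ (P.factorGraphModel.nbrV v).erase c, μ c' v) := by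
    ext1 β
    simp [FactorGraphModel.varMsg, tilt, factorGraphModel, add_comm]
  rw [hvar, sum_tilt, tilt_tilt, tilt_tilt, reducedWeight, ← nbrV_eq, ← Finset.add_sum_erase _ _ hc]
  ring_nf

theorem finalValue_eq_tilt (P : PackingProblem V C) (y : C → ℝ) (t : ℕ) (v : V) :
    P.factorGraphModel.finalValue t v = tilt (P.reducedWeight y v)
      (∑ c ∈ P.factorGraphModel.nbrV v, tilt (y c) (P.factorGraphModel.msg t c v)) := by
  rw [sum_tilt, tilt_tilt, reducedWeight, ← nbrV_eq, sub_add_cancel]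
  ext1 β
  simp [FactorGraphModel.finalValue, tilt, factorGraphModel, add_comm]

theorem tilt_conMsg_le_tilt_conMsg (hv : v ∈ P.factorGraphModel.nbrC c) {a : ℝ} {β γ : ℕ}
    (h : ∀ z ∈ zBox P.X, z v = β → ∑ u ∈ P.factorGraphModel.nbrC c, z u ≤ P.b c →
      ∃ z' ∈ zBox P.X, z' v = γ ∧ ∑ u ∈ P.factorGraphModel.nbrC c, z' u ≤ P.b c ∧
        a * ∑ u ∈ P.factorGraphModel.nbrC c, z u ≤ a * ∑ u ∈ P.factorGraphModel.nbrC c, z' u ∧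
        ∀ u ∈ P.factorGraphModel.nbrC c, u ≠ v →
          tilt (-a) (ν u c) (z u) ≤ tilt (-a) (ν u c) (z' u)) :
    tilt a (P.factorGraphModel.conMsg ν c v) β ≤ tilt a (P.factorGraphModel.conMsg ν c v) γ := by
  refine FactorGraphModel.conMsg_add_le_conMsg_add fun z hz hzv hzψ => ?_
  obtain ⟨z', hz', hz'v, hz'b, hsum, hle⟩ := h z hz hzv (psi_eq_zero_iff.1 hzψ)
  refine ⟨z', hz', hz'v, psi_eq_zero_iff.2 hz'b, ?_⟩
  rw [← hzv, ← hz'v, tilt_sum_erase_apply hv (ν · c), tilt_sum_erase_apply hv (ν · c)]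
  exact add_le_add
    (Finset.sum_le_sum fun u hu => hle u (Finset.mem_of_mem_erase hu) (Finset.ne_of_mem_erase hu))
    (WithBot.coe_le_coe.2 (by exact_mod_cast hsum))

namespace IsOptimalPair

theorem antitoneOn_tilt_varMsg (h : P.IsOptimalPair x y) (hc : c ∈ P.factorGraphModel.nbrV v)
    (hμ : ∀ c' ∈ P.factorGraphModel.nbrV v,
      AntitoneOn (tilt (y c') (μ c' v)) (Set.Icc ⌊x v⌋₊ (P.X v))) :
    AntitoneOn (tilt (-y c) (P.factorGraphModel.varMsg μ v c)) (Set.Icc ⌊x v⌋₊ (P.X v)) := by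
  rw [tilt_varMsg hc]
  exact h.antitoneOn_tilt_reducedWeight
    (antitoneOn_sum fun c' hc' => hμ c' (Finset.mem_of_mem_erase hc'))

theorem monotoneOn_tilt_varMsg (h : P.IsOptimalPair x y) (hc : c ∈ P.factorGraphModel.nbrV v)
    (hμ : ∀ c' ∈ P.factorGraphModel.nbrV v,
      MonotoneOn (tilt (y c') (μ c' v)) (Set.Iic ⌈x v⌉₊)) :
    MonotoneOn (tilt (-y c) (P.factorGraphModel.varMsg μ v c)) (Set.Iic ⌈x v⌉₊) := by
  rw [tilt_varMsg hc]
  exact h.monotoneOn_tilt_reducedWeight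
    (monotoneOn_sum fun c' hc' => hμ c' (Finset.mem_of_mem_erase hc'))

theorem monotoneOn_tilt_conMsg (h : P.IsOptimalPair x y) (hv : v ∈ P.factorGraphModel.nbrC c)
    (hν : ∀ u ∈ P.factorGraphModel.nbrC c,
      AntitoneOn (tilt (-y c) (ν u c)) (Set.Icc ⌊x u⌋₊ (P.X u))) :
    MonotoneOn (tilt (y c) (P.factorGraphModel.conMsg ν c v)) (Set.Iic ⌈x v⌉₊) := by
  obtain ⟨hbox, hxb⟩ := mem_feasibleLP.1 h.feasible
  refine monotoneOn_of_le_add_one Set.ordConnected_Iic fun β _ _ hβ => ?_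
  refine tilt_conMsg_le_tilt_conMsg hv fun z hz hzv hzb => ?_
  obtain ⟨z', hz', hz'v, hz'b, hsum, hothers⟩ := exists_raise_coordinate hbox
    (nbrC_eq P c ▸ hxb c) hz hzb hv (hzv ▸ Nat.lt_ceil.1 hβ)
  refine ⟨z', hz', hzv ▸ hz'v, hz'b,
    mul_le_mul_of_nonneg_left (by exact_mod_cast hsum) (h.nonneg c), fun u hu huv => ?_⟩
  have hzX := mem_zBox.1 hz u
  rcases hothers u huv with heq | ⟨hfloor, hle⟩
  · rw [heq]
  · exact hν u hu ⟨hfloor, hle.trans hzX⟩ ⟨hfloor.trans hle, hzX⟩ hle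

theorem antitoneOn_tilt_conMsg (h : P.IsOptimalPair x y) (hv : v ∈ P.factorGraphModel.nbrC c)
    (hν : ∀ u ∈ P.factorGraphModel.nbrC c,
      MonotoneOn (tilt (-y c) (ν u c)) (Set.Iic ⌈x u⌉₊)) :
    AntitoneOn (tilt (y c) (P.factorGraphModel.conMsg ν c v)) (Set.Icc ⌊x v⌋₊ (P.X v)) := by
  obtain ⟨hbox, -⟩ := mem_feasibleLP.1 h.feasible
  refine antitoneOn_of_add_one_le Set.ordConnected_Icc fun β _ hβ _ => ?_
  refine tilt_conMsg_le_tilt_conMsg hv fun z hz hzv hzb => ?_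
  have hxz : x v < z v := Nat.lt_of_floor_lt (hzv ▸ Nat.lt_succ_of_le hβ.1)
  obtain ⟨z', hz', hz'v, hz'b, htight, hothers⟩ := exists_lower_coordinate hbox hz hzb hv hxz
  refine ⟨z', hz', Nat.succ_injective (hz'v.trans hzv), hz'b, ?_, fun u hu huv => ?_⟩
  · rcases (h.nonneg c).eq_or_lt with hy | hy
    · simp [← hy]
    · have hsum := htight (nbrC_eq P c ▸ h.tight c hy)
      exact_mod_cast (congrArg (fun n : ℕ => y c * n) hsum).ge
  · rcases hothers u huv with heq | ⟨hle, hceil⟩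
    · rw [heq]
    · exact hν u hu (hle.trans hceil) hceil hle

theorem tilt_msg (h : P.IsOptimalPair x y) (t : ℕ) (hv : v ∈ P.factorGraphModel.nbrC c) :
    (Even t → MonotoneOn (tilt (y c) (P.factorGraphModel.msg t c v)) (Set.Iic ⌈x v⌉₊)) ∧
      (Odd t → AntitoneOn (tilt (y c) (P.factorGraphModel.msg t c v))
        (Set.Icc ⌊x v⌋₊ (P.X v))) := by
  induction t generalizing c v with
  | zero => exact ⟨fun _ => monotoneOn_tilt (h.nonneg c) monotoneOn_const, by simp⟩
  | succ t ih =>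
    refine ⟨fun ht => ?_, fun ht => ?_⟩
    · have ht' : Odd t := by simpa [parity_simps] using ht
      exact h.monotoneOn_tilt_conMsg hv fun u hu =>
        h.antitoneOn_tilt_varMsg (mem_nbrV_iff_mem_nbrC.2 hu) fun c' hc' =>
          (ih (mem_nbrV_iff_mem_nbrC.1 hc')).2 ht'
    · have ht' : Even t := by simpa [parity_simps] using ht
      exact h.antitoneOn_tilt_conMsg hv fun u hu =>
        h.monotoneOn_tilt_varMsg (mem_nbrV_iff_mem_nbrC.2 hu) fun c' hc' =>
          (ih (mem_nbrV_iff_mem_nbrC.1 hc')).1 ht'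

theorem monotoneOn_finalValue (h : P.IsOptimalPair x y) {t : ℕ} (ht : Even t) (v : V) :
    MonotoneOn (P.factorGraphModel.finalValue t v) (Set.Iic ⌈x v⌉₊) := by
  rw [finalValue_eq_tilt P y]
  exact h.monotoneOn_tilt_reducedWeight
    (monotoneOn_sum fun c hc => (h.tilt_msg t (mem_nbrV_iff_mem_nbrC.1 hc)).1 ht)

theorem antitoneOn_finalValue (h : P.IsOptimalPair x y) {t : ℕ} (ht : Odd t) (v : V) :
    AntitoneOn (P.factorGraphModel.finalValue t v) (Set.Icc ⌊x v⌋₊ (P.X v)) := by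
  rw [finalValue_eq_tilt P y]
  exact h.antitoneOn_tilt_reducedWeight
    (antitoneOn_sum fun c hc => (h.tilt_msg t (mem_nbrV_iff_mem_nbrC.1 hc)).2 ht)

end IsOptimalPair

end Messages

end PackingProblem

theorem mainTheorem2_general {V C : Type*} [Fintype V] [Fintype C] [DecidableEq V]
    [DecidableEq C] (P : PackingProblem V C) (r : V) (x : V → ℝ) (hx : x ∈ P.optLP) (t : ℕ) :
    (Even t → x r ≤ P.factorGraphModel.minSumPacking t r) ∧
      (Odd t → (P.factorGraphModel.minSumPacking t r : ℝ) ≤ x r) := by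
  obtain ⟨y, hy⟩ := PackingProblem.exists_isOptimalPair hx
  obtain ⟨hx0, hxX⟩ := (PackingProblem.mem_feasibleLP.1 hy.feasible).1 r
  refine ⟨fun ht => Nat.ceil_le.1 ?_, fun ht => (Nat.le_floor_iff hx0).1 ?_⟩
  · exact FactorGraphModel.le_minSumPacking ht (Nat.ceil_le.2 hxX) (hy.monotoneOn_finalValue ht r)
  · exact FactorGraphModel.minSumPacking_le ht (hy.antitoneOn_finalValue ht r)

theorem mainTheorem2 {V C : Type*} [Fintype V] [Fintype C] [DecidableEq V] [DecidableEq C]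
    (P : PackingProblem V C) (r : V) (x : V → ℝ) (hx : x ∈ P.optLP)
    (hr : ¬ ∃ k : ℤ, x r = (k : ℝ)) (t : ℕ) :
    (Even t → ⌈x r⌉ ≤ (P.factorGraphModel.minSumPacking t r : ℤ)) ∧
      (Odd t → (P.factorGraphModel.minSumPacking t r : ℤ) ≤ ⌊x r⌋) := by
  simpa only [Int.ceil_le, Int.le_floor, Int.cast_natCast] using mainTheorem2_general P r x hx t
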